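/- Let $\mathbb H$ be a separable real Hilbert space and let $W=(W(h))_{h\in\mathbb H}$ be an isonormal process on it, i.e. a centered Gaussian process with $\mathbb E[W(g)W(h)]=\langle g,h\rangle$ for all $g,h\in\mathbb H$. Let $\mathcal D=\{\varphi_1,\varphi_2,\dots\}\subset\mathbb H$ be an ordered countable dictionary with $\sup_{j\ge1}\|\varphi_j\|\le 1$, and suppose that almost every sample path $h\mapsto W(h)$ is linear on the linear span of $\mathcal D$. For $f\in\mathbb H$ and $\varepsilon>0$ one observes $Y(h)=\langle f,h\rangle+\varepsilon W(h)$, $h\in\mathbb H$; put $\gamma(h)=-2Y(h)+\|h\|^2$. For $p\ge1$ let $\mathcal D_p=\{\varphi_1,\dots,\varphi_p\}$, let $\mathcal L_1(\mathcal D_p)$ be the linear span of $\mathcal D_p$, and for $h\in\mathcal L_1(\mathcal D_p)$ let $$\|h\|_{\mathcal L_1(\mathcal D_p)}=\inf\Big\{\sum_{j=1}^p|\theta_j| : \theta\in\mathbb R^p,\ h=\sum_{j=1}^p\theta_j\varphi_j\Big\}.$$ Let $\Lambda=\{2^J: J=0,1,2,\dots\}$ and, for $p\in\Lambda$, put $$\lambda_p=4\varepsilon\big(\sqrt{\ln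 p}+1\big),\qquad \operatorname{pen}(p)=5\varepsilon^2\ln p .$$ For $p\in\Lambda$ let $\hat f_p$ be the Lasso estimator on $\mathcal D_p$, that is, a random element of $\mathbb H$ such that almost surely $\hat f_p$ minimizes $\gamma(h)+\lambda_p\|h\|_{\mathcal L_1(\mathcal D_p)}$ over $h\in\mathcal L_1(\mathcal D_p)$. Let $\hat p$ be a $\Lambda$-valued random variable that almost surely minimizes $$\gamma(\hat f_p)+\lambda_p\|\hat f_p\|_{\mathcal L_1(\mathcal D_p)}+\operatorname{pen}(p)$$ over $p\in\Lambda$. Then there is an absolute constant $C>0$ (in particular independent of $\mathbb H$, $W$, $\mathcal D$, $f$, $\varepsilon$, and of how ties are broken in the choice of $\hat p$) such that the random variable on the left is integrable and $$\mathbb E\Big[\|f-\hat f_{\hat p}\|^2+\lambda_{\hat p}\|\hat f_{\hat p}\|_{\mathcal L_1(\mathcal D_{\hat p})}+\operatorname{pen}(\hat p)\Big]\le C\Big[\inf_{p\in\Lambda}\Big(\inf_{h\in\mathcal L_1(\mathcal D_p)}\big(\|f-h\|^2+\lambda_p\|h\|_{\mathcal L_1(\mathcal D_p)}\big)+\operatorname{pen}(p)\Big)+\varepsilon^2\Big].$$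 -/

import Mathlib

open MeasureTheory ProbabilityTheory

noncomputable section

namespace LassoSelection

/-- A centered Gaussian process indexed by a Hilbert space `H` is isonormal if its covariance is
the scalar product of `H`. -/
structure IsIsonormal {Ω H : Type*} [MeasurableSpace Ω] [NormedAddCommGroup H]
    [InnerProductSpace ℝ H] (W : H → Ω → ℝ) (P : Measure Ω) : Prop where
  gaussian : IsGaussianProcess W P
  centered : ∀ h, ∫ ω, W h ω ∂P = 0
  covariance : ∀ g h, ∫ ω, W g ω * W h ω ∂P = inner ℝ g h

/-- Almost every sample path `h ↦ W h ω` is linear on the subspace `V`. -/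
def HasLinearPathsOn {Ω H : Type*} [MeasurableSpace Ω] [NormedAddCommGroup H]
    [InnerProductSpace ℝ H] (W : H → Ω → ℝ) (V : Submodule ℝ H) (P : Measure Ω) : Prop :=
  ∀ᵐ ω ∂P, ∃ L : V →ₗ[ℝ] ℝ, ∀ h : V, W (h : H) ω = L h

/-- The set of dyadic integers `{2 ^ J : J ∈ ℕ}`. -/
def dyadic : Set ℕ := Set.range (fun J : ℕ => 2 ^ J)

/-- The regularization parameter `λ_p = 4 ε (√(ln p) + 1)`. -/
def lam (ε : ℝ) (p : ℕ) : ℝ := 4 * ε * (Real.sqrt (Real.log p) + 1)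

/-- The penalty `pen(p) = 5 ε² ln p`. -/
def pen (ε : ℝ) (p : ℕ) : ℝ := 5 * ε ^ 2 * Real.log p

section Dictionary

variable {H : Type*} [NormedAddCommGroup H] [InnerProductSpace ℝ H]

/-- The linear span of the whole dictionary `{φ 0, φ 1, φ 2, …}`. -/
def spanDict (φ : ℕ → H) : Submodule ℝ H := Submodule.span ℝ (Set.range φ)

/-- The linear span of the dictionary truncated at level `p`, which consists of its first `p`
elements `φ 0, …, φ (p - 1)`. -/
def spanTrunc (φ : ℕ → H) (p : ℕ) : Submodule ℝ H := Submodule.span ℝ (φ '' Set.Iio p)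

/-- The `ℓ₁`-norm of `h` relative to the dictionary truncated at level `p`: the infimum of
`∑ |θ_j|` over all `θ ∈ ℝ^p` such that `h = ∑ θ_j φ_j`. -/
def l1Norm (φ : ℕ → H) (p : ℕ) (h : H) : ℝ :=
  sInf {r : ℝ | ∃ θ : Fin p → ℝ, h = ∑ j, θ j • φ j ∧ r = ∑ j, |θ j|}

/-- The observed process `Y(h) = ⟨f, h⟩ + ε W(h)`. -/
def obs {Ω : Type*} (f : H) (ε : ℝ) (W : H → Ω → ℝ) (h : H) (ω : Ω) : ℝ :=
  inner ℝ f h + ε * W h ω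

/-- The empirical least squares criterion `γ(h) = -2 Y(h) + ‖h‖²` of an observation `y` of `Y`. -/
def gam (y : H → ℝ) (h : H) : ℝ := -2 * y h + ‖h‖ ^ 2

/-- `g` minimizes `γ(h) + λ_p ‖h‖_{L₁(D_p)}` over `h ∈ L₁(D_p)`, when the observation is `y`. -/
def IsLasso (φ : ℕ → H) (ε : ℝ) (y : H → ℝ) (p : ℕ) (g : H) : Prop :=
  g ∈ spanTrunc φ p ∧
    ∀ h ∈ spanTrunc φ p, gam y g + lam ε p * l1Norm φ p g ≤ gam y h + lam ε p * l1Norm φ p h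

/-- `q` minimizes `γ(g p) + λ_p ‖g p‖_{L₁(D_p)} + pen(p)` over the dyadic integers `p`, when the
observation is `y`. -/
def IsSelected (φ : ℕ → H) (ε : ℝ) (y : H → ℝ) (g : ℕ → H) (q : ℕ) : Prop :=
  q ∈ dyadic ∧
    ∀ p ∈ dyadic, gam y (g q) + lam ε q * l1Norm φ q (g q) + pen ε q
      ≤ gam y (g p) + lam ε p * l1Norm φ p (g p) + pen ε p

end Dictionary

end LassoSelection

end

/-!
The loss of the selected estimator is controlled path by path. Fix `p` and a competitor `h` in the
span of the first `p` elements of the dictionary, and let `g` be the selected Lasso estimator, of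
level `q`. The two minimization properties and `γ(g) = ‖f - g‖² - ‖f‖² - 2 ε W(g)` give
`‖f - g‖² + λ_q ‖g‖₁ + pen(q) ≤ ‖f - h‖² + λ_p ‖h‖₁ + pen(p) + 2 ε (W(g) - W(h))`,
so that everything rests on a bound of `W(g) - W(h)` which is uniform in `g` and in `q`.

Let `τ_j` be slightly smaller than `2 (√(ln (j + 1)) + 1)`, chosen so that with probability at least
`1/4` all the constraints `|W(φ_j)| ≤ τ_j` and `|W(h)| ≤ 3 ‖h‖` hold. On a finite-dimensional
subspace `V`, the process `W` is the scalar product with a standard Gaussian vector `w` of `V`, and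
these constraints say that `w` lies in a closed convex set `K`. Splitting `w` into its projection on
`K` and the remainder yields, for `g = ∑ θ_j φ_j`,
`W(g) - W(h) ≤ ∑ τ_j |θ_j| + 3 ‖h‖ + D ‖g - h‖`, where `D = dist(w, K)`
(`exists_deviation_bound`, `exists_noise_bound`). The first term is absorbed by `λ_q ‖g‖₁`, the
second one by `λ_p ‖h‖₁`, and the third one is at most a fraction of `‖f - g‖² + ‖f - h‖²` plus a
multiple of `ε² D²` (`loss_le_of_noise_le`).

It remains to bound `𝔼 D²` by a constant which depends neither on the dimension nor on `K`. The
distance to `K` has subgradients of norm at most `1`, so it satisfies a Poincaré inequality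
`𝔼 (D - D')² ≤ 6`, with `D'` an independent copy of `D` (`lintegral_sq_sub_le`). Since `D' = 0` with
probability at least `1/4`, this forces `𝔼 D² ≤ 24`. The Poincaré inequality follows from the
invariance of a pair of independent Gaussian vectors under rotation: one moves from `X` to `Y`
along `X cos θ + Y sin θ` in many small steps, and the subgradient inequality at both ends of a step
replaces differentiability.

The bound holds on each event `q ≤ N` with a constant free of `N`, so `N → ∞` finishes the proof.
-/

noncomputable section

open MeasureTheory ProbabilityTheory

open scoped RealInnerProductSpace

namespace LassoSelection

/-! ### Distance to a closed convex set -/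

section Projection

variable {E : Type*} [NormedAddCommGroup E] [InnerProductSpace ℝ E]

/-- The metric projection on a closed convex set, through its variational characterization. -/
theorem exists_projection [FiniteDimensional ℝ E] {K : Set E} (hne : K.Nonempty)
    (hcl : IsClosed K) (hcv : Convex ℝ K) :
    ∃ π : E → E, ∀ x, π x ∈ K ∧ ∀ w ∈ K, ⟪x - π x, w - π x⟫ ≤ 0 := by
  have : ProperSpace E := FiniteDimensional.proper ℝ E
  choose π hπ hmin using exists_norm_eq_iInf_of_complete_convex hne hcl.isComplete hcv
  exact ⟨π, fun x => ⟨hπ x, (norm_eq_iInf_iff_real_inner_le_zero hcv (hπ x)).1 (hmin x)⟩⟩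

variable {K : Set E} {π : E → E}

theorem continuous_projection (hπ : ∀ x, π x ∈ K ∧ ∀ w ∈ K, ⟪x - π x, w - π x⟫ ≤ 0) :
    Continuous π := by
  have h : LipschitzWith 1 π := by
    refine LipschitzWith.of_dist_le_mul fun x y => ?_
    rw [dist_eq_norm, dist_eq_norm, NNReal.coe_one, one_mul]
    have h1 := (hπ x).2 _ (hπ y).1
    have h2 := (hπ y).2 _ (hπ x).1
    have h3 : ‖π x - π y‖ ^ 2 ≤ ⟪x - y, π x - π y⟫ := by
      have e : ⟪x - π x, π y - π x⟫ + ⟪y - π y, π x - π y⟫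
          = ‖π x - π y‖ ^ 2 - ⟪x - y, π x - π y⟫ := by
        rw [← real_inner_self_eq_norm_sq, ← inner_neg_neg (x - π x) (π y - π x),
          neg_sub, neg_sub, ← inner_add_left, ← inner_sub_left]
        congr 1
        abel
      linarith
    have h4 := real_inner_le_norm (x - y) (π x - π y)
    by_contra! hlt
    nlinarith [norm_nonneg (x - y), norm_nonneg (π x - π y)]
  exact h.continuous

/-- The unit vector pointing from the projection `π x` to `x`, which is a subgradient at `x` of the
distance to the convex set. It is `0` if `x = π x`. -/
def projDir (π : E → E) (x : E) : E := ‖x - π x‖⁻¹ • (x - π x)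

theorem norm_projDir_le (π : E → E) (x : E) : ‖projDir π x‖ ≤ 1 := by
  rw [projDir, norm_smul, norm_inv, norm_norm]
  exact inv_mul_le_one

/-- The subgradient inequality for the distance `‖x - π x‖` to `K`. -/
theorem norm_sub_norm_le_inner_projDir
    (hπ : ∀ x, π x ∈ K ∧ ∀ w ∈ K, ⟪x - π x, w - π x⟫ ≤ 0) (x y : E) :
    ‖x - π x‖ - ‖y - π y‖ ≤ ⟪projDir π x, x - y⟫ := by
  have h1 := (hπ x).2 _ (hπ y).1
  have h2 : ⟪projDir π x, x - π x⟫ = ‖x - π x‖ := by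
    rw [projDir, real_inner_smul_left, real_inner_self_eq_norm_sq]
    rcases eq_or_ne ‖x - π x‖ 0 with h | h
    · simp [h]
    · field_simp
  have h3 : ⟪projDir π x, π y - π x⟫ ≤ 0 := by
    rw [projDir, real_inner_smul_left]
    exact mul_nonpos_of_nonneg_of_nonpos (by positivity) h1
  have h4 : ⟪projDir π x, y - π y⟫ ≤ ‖y - π y‖ :=
    (real_inner_le_norm _ _).trans
      (mul_le_of_le_one_left (norm_nonneg _) (norm_projDir_le π x))
  have e : x - y = (x - π x) - (π y - π x) - (y - π y) := by abel
  rw [e, inner_sub_right, inner_sub_right, h2]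
  linarith

end Projection

/-! ### A Poincaré inequality for Gaussian measures -/

section Poincare

variable {E : Type*} [NormedAddCommGroup E] [InnerProductSpace ℝ E] [FiniteDimensional ℝ E]
  [MeasurableSpace E] [BorelSpace E] {μ : Measure E} [IsGaussian μ]

theorem lintegral_sq_inner_add (hcent : μ[id] = 0) (hcov : ∀ u, ∫ y, ⟪u, y⟫ ^ 2 ∂μ = ‖u‖ ^ 2)
    (u x : E) (a b : ℝ) :
    ∫⁻ y, ENNReal.ofReal (⟪u, a • x + b • y⟫ ^ 2) ∂μ
      = ENNReal.ofReal (a ^ 2 * ⟪u, x⟫ ^ 2 + b ^ 2 * ‖u‖ ^ 2) := by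
  have hL2 : MemLp (fun y : E => ⟪u, y⟫) 2 μ :=
    (IsGaussian.memLp_two_id (μ := μ)).const_inner u
  have hint : Integrable (fun y : E => ⟪u, y⟫) μ := hL2.integrable one_le_two
  have hmean : ∫ y, ⟪u, y⟫ ∂μ = 0 := by
    have := integral_inner (𝕜 := ℝ) (IsGaussian.integrable_id (μ := μ)) u
    simp only [id] at this hcent
    rw [this, hcent, inner_zero_right]
  have e : ∀ y : E, ⟪u, a • x + b • y⟫ ^ 2
      = (a ^ 2 * ⟪u, x⟫ ^ 2 + (2 * a * b * ⟪u, x⟫) * ⟪u, y⟫) + b ^ 2 * ⟪u, y⟫ ^ 2 := by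
    intro y
    rw [inner_add_right, real_inner_smul_right, real_inner_smul_right]
    ring
  have hI1 : Integrable (fun y : E => a ^ 2 * ⟪u, x⟫ ^ 2 + (2 * a * b * ⟪u, x⟫) * ⟪u, y⟫) μ :=
    (integrable_const _).add (hint.const_mul _)
  have hI2 : Integrable (fun y : E => b ^ 2 * ⟪u, y⟫ ^ 2) μ := hL2.integrable_sq.const_mul _
  rw [← ofReal_integral_eq_lintegral_ofReal]
  · simp only [e]
    rw [integral_add hI1 hI2, integral_add (integrable_const _) (hint.const_mul _),
      integral_const_mul, integral_const_mul, integral_const_mul, hmean, hcov]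
    simp
  · simp only [e]
    exact hI1.add hI2
  · exact Filter.Eventually.of_forall fun y => sq_nonneg _

/-- The second variable is independent of the direction `u p.1`, hence contributes `b²` and not `b²`
times the dimension. -/
theorem lintegral_prod_sq_inner_le (hcent : μ[id] = 0)
    (hcov : ∀ u, ∫ y, ⟪u, y⟫ ^ 2 ∂μ = ‖u‖ ^ 2) {u : E → E} (hu : Measurable u)
    (hu1 : ∀ x, ‖u x‖ ≤ 1) (a b : ℝ) :
    ∫⁻ p : E × E, ENNReal.ofReal (⟪u p.1, a • p.1 + b • p.2⟫ ^ 2) ∂(μ.prod μ)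
      ≤ ENNReal.ofReal (a ^ 2 * (∫ x, ‖x‖ ^ 2 ∂μ) + b ^ 2) := by
  have hI : Integrable (fun x : E => ‖x‖ ^ 2) μ := by
    simpa using (IsGaussian.memLp_two_id (μ := μ)).integrable_norm_pow two_ne_zero
  rw [lintegral_prod _ (by fun_prop)]
  simp only [lintegral_sq_inner_add hcent hcov]
  calc ∫⁻ x, ENNReal.ofReal (a ^ 2 * ⟪u x, x⟫ ^ 2 + b ^ 2 * ‖u x‖ ^ 2) ∂μ
      ≤ ∫⁻ x, ENNReal.ofReal (a ^ 2 * ‖x‖ ^ 2 + b ^ 2) ∂μ := by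
        refine lintegral_mono fun x => ENNReal.ofReal_le_ofReal ?_
        have h1 : |⟪u x, x⟫| ≤ ‖x‖ := (abs_real_inner_le_norm _ _).trans
          (mul_le_of_le_one_left (norm_nonneg _) (hu1 x))
        have h2 : ⟪u x, x⟫ ^ 2 ≤ ‖x‖ ^ 2 := by
          rw [← sq_abs]; gcongr
        have h3 : ‖u x‖ ^ 2 ≤ 1 := pow_le_one₀ (norm_nonneg _) (hu1 x)
        have h4 : b ^ 2 * ‖u x‖ ^ 2 ≤ b ^ 2 := mul_le_of_le_one_right (sq_nonneg _) h3
        gcongr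
    _ = ENNReal.ofReal (a ^ 2 * (∫ x, ‖x‖ ^ 2 ∂μ) + b ^ 2) := by
        rw [← ofReal_integral_eq_lintegral_ofReal]
        · rw [integral_add (hI.const_mul _) (integrable_const _), integral_const_mul]
          simp
        · exact (hI.const_mul _).add (integrable_const _)
        · exact Filter.Eventually.of_forall fun y => by positivity

theorem lintegral_comp_rotation (hcent : μ[id] = 0) (θ : ℝ) {g : E × E → ENNReal}
    (hg : Measurable g) :
    ∫⁻ p : E × E, g (Real.cos θ • p.1 + Real.sin θ • p.2, -Real.sin θ • p.1 + Real.cos θ • p.2)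
      ∂(μ.prod μ) = ∫⁻ p, g p ∂(μ.prod μ) := by
  conv_rhs => rw [← IsGaussian.map_rotation_eq_self (μ := μ) hcent θ]
  rw [lintegral_map hg (by fun_prop)]
  simp only [ContinuousLinearMap.rotation_apply]

/-- One step of the path. For a small angle `t` the bound is `2 t²` up to higher order, so that the
dimension, which enters through `∫ ‖x‖² ∂μ`, disappears in the limit. -/
theorem lintegral_sq_sub_rotation_le (hcent : μ[id] = 0)
    (hcov : ∀ u, ∫ y, ⟪u, y⟫ ^ 2 ∂μ = ‖u‖ ^ 2) {F : E → ℝ} {u : E → E} (hu : Measurable u)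
    (hu1 : ∀ x, ‖u x‖ ≤ 1) (hF : ∀ x y, F x - F y ≤ ⟪u x, x - y⟫) (t : ℝ) :
    ∫⁻ p : E × E, ENNReal.ofReal ((F p.1 - F (Real.cos t • p.1 + Real.sin t • p.2)) ^ 2)
        ∂(μ.prod μ)
      ≤ ENNReal.ofReal (2 * ((1 - Real.cos t) ^ 2 * (∫ x, ‖x‖ ^ 2 ∂μ) + Real.sin t ^ 2)) := by
  set c := Real.cos t with hc
  set s := Real.sin t with hs
  have hcs : c ^ 2 + s ^ 2 = 1 := Real.cos_sq_add_sin_sq t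
  have hM : 0 ≤ ∫ x, ‖x‖ ^ 2 ∂μ := integral_nonneg fun x => by positivity
  let g : E × E → ENNReal := fun p => ENNReal.ofReal (⟪u p.1, (c - 1) • p.1 + (-s) • p.2⟫ ^ 2)
  have hg : Measurable g := by fun_prop
  calc ∫⁻ p : E × E, ENNReal.ofReal ((F p.1 - F (c • p.1 + s • p.2)) ^ 2) ∂(μ.prod μ)
      ≤ ∫⁻ p : E × E, (ENNReal.ofReal (⟪u p.1, (1 - c) • p.1 + (-s) • p.2⟫ ^ 2)
          + g (c • p.1 + s • p.2, -s • p.1 + c • p.2)) ∂(μ.prod μ) := by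
        refine lintegral_mono fun p => ?_
        obtain ⟨x, y⟩ := p
        simp only [g]
        rw [← ENNReal.ofReal_add (sq_nonneg _) (sq_nonneg _)]
        refine ENNReal.ofReal_le_ofReal ?_
        have e1 : x - (c • x + s • y) = (1 - c) • x + (-s) • y := by module
        -- Seen from the rotated pair, `x` is obtained by the rotation of the opposite angle.
        have e2 : (c • x + s • y) - x
            = -((c - 1) • (c • x + s • y) + (-s) • (-s • x + c • y)) := by
          have : (c • x + s • y) - x = (c • x + s • y) - (c ^ 2 + s ^ 2) • x := by
            rw [hcs, one_smul]
          rw [this]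
          module
        have h1 := hF x (c • x + s • y)
        have h2 := hF (c • x + s • y) x
        rw [e1] at h1
        rw [e2, inner_neg_right] at h2
        generalize ⟪u x, (1 - c) • x + (-s) • y⟫ = A at *
        generalize ⟪u (c • x + s • y), (c - 1) • (c • x + s • y) + (-s) • (-s • x + c • y)⟫ = B at *
        rcases le_total (F x - F (c • x + s • y)) 0 with h | h <;> nlinarith
    _ ≤ ENNReal.ofReal ((1 - c) ^ 2 * (∫ x, ‖x‖ ^ 2 ∂μ) + s ^ 2)
        + ENNReal.ofReal ((1 - c) ^ 2 * (∫ x, ‖x‖ ^ 2 ∂μ) + s ^ 2) := by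
        rw [lintegral_add_left (by fun_prop), lintegral_comp_rotation hcent t hg]
        refine add_le_add ?_ ?_
        · simpa using lintegral_prod_sq_inner_le hcent hcov hu hu1 (1 - c) (-s)
        · have := lintegral_prod_sq_inner_le hcent hcov hu hu1 (c - 1) (-s)
          rwa [neg_sq, ← neg_sq (c - 1), neg_sub] at this
    _ = ENNReal.ofReal (2 * ((1 - c) ^ 2 * (∫ x, ‖x‖ ^ 2 ∂μ) + s ^ 2)) := by
        rw [← ENNReal.ofReal_add (by positivity) (by positivity), two_mul]

/-- The path from `p.1` to `p.2` is cut into `N` rotations of angle `t`. All the increments have the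
same law. -/
theorem lintegral_sq_sub_le_of_angle (hcent : μ[id] = 0)
    (hcov : ∀ u, ∫ y, ⟪u, y⟫ ^ 2 ∂μ = ‖u‖ ^ 2) {F : E → ℝ} {u : E → E} (hFm : Measurable F)
    (hu : Measurable u) (hu1 : ∀ x, ‖u x‖ ≤ 1) (hF : ∀ x y, F x - F y ≤ ⟪u x, x - y⟫)
    (N : ℕ) (t : ℝ) (ht : N * t = Real.pi / 2) :
    ∫⁻ p : E × E, ENNReal.ofReal ((F p.1 - F p.2) ^ 2) ∂(μ.prod μ)
      ≤ ENNReal.ofReal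
        (2 * N ^ 2 * ((1 - Real.cos t) ^ 2 * (∫ x, ‖x‖ ^ 2 ∂μ) + Real.sin t ^ 2)) := by
  let X : ℕ → E × E → E := fun k p => Real.cos (k * t) • p.1 + Real.sin (k * t) • p.2
  let G : E × E → ENNReal := fun p =>
    ENNReal.ofReal ((F p.1 - F (Real.cos t • p.1 + Real.sin t • p.2)) ^ 2)
  have hG : Measurable G := by fun_prop
  have hstep : ∀ k p, ENNReal.ofReal ((F (X k p) - F (X (k + 1) p)) ^ 2)
      = G (Real.cos (k * t) • p.1 + Real.sin (k * t) • p.2,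
        -Real.sin (k * t) • p.1 + Real.cos (k * t) • p.2) := by
    intro k p
    have : X (k + 1) p = Real.cos t • (Real.cos (k * t) • p.1 + Real.sin (k * t) • p.2)
        + Real.sin t • (-Real.sin (k * t) • p.1 + Real.cos (k * t) • p.2) := by
      simp only [X]
      have e : ((k + 1 : ℕ) : ℝ) * t = k * t + t := by push_cast; ring
      rw [e, Real.cos_add, Real.sin_add]
      module
    simp only [G, this, X]
  calc ∫⁻ p : E × E, ENNReal.ofReal ((F p.1 - F p.2) ^ 2) ∂(μ.prod μ)
      ≤ ∫⁻ p : E × E, ENNReal.ofReal N * ∑ k ∈ Finset.range N,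
          ENNReal.ofReal ((F (X k p) - F (X (k + 1) p)) ^ 2) ∂(μ.prod μ) := by
        refine lintegral_mono fun p => ?_
        rw [← ENNReal.ofReal_sum_of_nonneg fun _ _ => sq_nonneg _,
          ← ENNReal.ofReal_mul (Nat.cast_nonneg _)]
        refine ENNReal.ofReal_le_ofReal ?_
        have h0 : X 0 p = p.1 := by simp [X]
        have hN : X N p = p.2 := by simp [X, ht]
        have := sq_sum_le_card_mul_sum_sq (s := Finset.range N)
          (f := fun k => F (X k p) - F (X (k + 1) p))
        rwa [Finset.sum_range_sub', h0, hN, Finset.card_range] at this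
    _ = ENNReal.ofReal N * ∑ k ∈ Finset.range N, ∫⁻ p : E × E, G p ∂(μ.prod μ) := by
        rw [lintegral_const_mul _ (by fun_prop), lintegral_finsetSum _ (by fun_prop)]
        simp only [hstep]
        congr 1
        exact Finset.sum_congr rfl fun k _ => lintegral_comp_rotation hcent (k * t) hG
    _ ≤ ENNReal.ofReal N * ∑ k ∈ Finset.range N,
          ENNReal.ofReal (2 * ((1 - Real.cos t) ^ 2 * (∫ x, ‖x‖ ^ 2 ∂μ) + Real.sin t ^ 2)) := by
        gcongr
        exact lintegral_sq_sub_rotation_le hcent hcov hu hu1 hF t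
    _ = _ := by
        rw [Finset.sum_const, Finset.card_range, nsmul_eq_mul, ← ENNReal.ofReal_natCast,
          ← ENNReal.ofReal_mul (by positivity), ← ENNReal.ofReal_mul (by positivity)]
        congr 1
        ring

/-- A **Poincaré inequality** for a standard Gaussian measure and a function which has subgradients
of norm at most `1` everywhere. The constant, slightly more than `π² / 2`, does not depend on the
dimension. -/
theorem lintegral_sq_sub_le (hcent : μ[id] = 0)
    (hcov : ∀ u, ∫ y, ⟪u, y⟫ ^ 2 ∂μ = ‖u‖ ^ 2) {F : E → ℝ} {u : E → E} (hFm : Measurable F)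
    (hu : Measurable u) (hu1 : ∀ x, ‖u x‖ ≤ 1) (hF : ∀ x y, F x - F y ≤ ⟪u x, x - y⟫) :
    ∫⁻ p : E × E, ENNReal.ofReal ((F p.1 - F p.2) ^ 2) ∂(μ.prod μ) ≤ 6 := by
  set M := ∫ x, ‖x‖ ^ 2 ∂μ with hMdef
  have hM : 0 ≤ M := integral_nonneg fun x => by positivity
  -- The number `N` of steps is so large that the term of order `M / N²` is negligible.
  obtain ⟨n, hn⟩ := exists_nat_gt (6 * M)
  have hN1 : (1 : ℝ) ≤ ((n + 1 : ℕ) : ℝ) := by exact_mod_cast Nat.le_add_left 1 n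
  have hNM : 6 * M ≤ ((n + 1 : ℕ) : ℝ) := by push_cast; linarith
  generalize n + 1 = N at hN1 hNM
  have hpos : (0 : ℝ) < N := by linarith
  have ht : N * (Real.pi / (2 * N)) = Real.pi / 2 := by field_simp
  set t := Real.pi / (2 * N) with htdef
  have ht0 : 0 ≤ t := by positivity
  refine (lintegral_sq_sub_le_of_angle hcent hcov hFm hu hu1 hF N t ht).trans ?_
  rw [show (6 : ENNReal) = ENNReal.ofReal 6 by simp]
  refine ENNReal.ofReal_le_ofReal ?_
  have hsin : Real.sin t ^ 2 ≤ t ^ 2 := by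
    rw [← sq_abs (Real.sin t)]
    have := Real.abs_sin_le_abs (x := t)
    rw [← sq_abs t]
    gcongr
  have hcos : (1 - Real.cos t) ^ 2 ≤ (t ^ 2 / 2) ^ 2 := by
    have h1 := Real.one_sub_sq_div_two_le_cos (x := t)
    have h2 := Real.cos_le_one t
    exact pow_le_pow_left₀ (by linarith) (by linarith) 2
  have hpi : (N * t) ^ 2 ≤ 2.4675 := by
    rw [ht]
    have := Real.pi_lt_d4
    nlinarith [Real.pi_pos]
  have hMt : M * t ^ 2 ≤ 2.4675 / 6 := by
    have h1 : 6 * M * t ^ 2 ≤ N ^ 2 * t ^ 2 := by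
      gcongr
      nlinarith
    nlinarith
  calc 2 * (N : ℝ) ^ 2 * ((1 - Real.cos t) ^ 2 * M + Real.sin t ^ 2)
      ≤ 2 * (N : ℝ) ^ 2 * ((t ^ 2 / 2) ^ 2 * M + t ^ 2) := by gcongr
    _ = 2 * (N * t) ^ 2 * (1 + M * t ^ 2 / 4) := by ring
    _ ≤ 2 * 2.4675 * (1 + 2.4675 / 6 / 4) := by gcongr
    _ ≤ 6 := by norm_num

/-- The mean square distance of a standard Gaussian vector to a convex set of measure at least `1/4`
is bounded by a constant: compare the vector with an independent copy which lies in the set. -/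
theorem lintegral_sq_norm_sub_projection_le (hcent : μ[id] = 0)
    (hcov : ∀ u, ∫ y, ⟪u, y⟫ ^ 2 ∂μ = ‖u‖ ^ 2) {K : Set E} {π : E → E}
    (hπ : ∀ x, π x ∈ K ∧ ∀ w ∈ K, ⟪x - π x, w - π x⟫ ≤ 0) (hK : MeasurableSet K)
    (hμK : 1 / 4 ≤ μ K) :
    ∫⁻ x, ENNReal.ofReal (‖x - π x‖ ^ 2) ∂μ ≤ 24 := by
  have hπm : Measurable π := (continuous_projection hπ).measurable
  have hK0 : ∀ x ∈ K, ‖x - π x‖ = 0 := by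
    intro x hx
    have := (hπ x).2 x hx
    rw [real_inner_self_eq_norm_sq] at this
    nlinarith [norm_nonneg (x - π x)]
  have h := lintegral_sq_sub_le hcent hcov (F := fun x => ‖x - π x‖) (u := projDir π)
    (by fun_prop) (by unfold projDir; fun_prop) (norm_projDir_le π)
    (norm_sub_norm_le_inner_projDir hπ)
  have h1 : (∫⁻ x, ENNReal.ofReal (‖x - π x‖ ^ 2) ∂μ) * μ K ≤ 6 := by
    refine le_trans ?_ h
    rw [← lintegral_indicator_one hK, ← lintegral_prod_mul (by fun_prop)
      ((measurable_one.indicator hK).aemeasurable)]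
    refine lintegral_mono fun p => ?_
    by_cases hp : p.2 ∈ K
    · simp [hp, hK0 p.2 hp]
    · simp [hp]
  have h2 : (∫⁻ x, ENNReal.ofReal (‖x - π x‖ ^ 2) ∂μ) * (1 / 4) ≤ 6 :=
    (mul_le_mul_right hμK _).trans h1
  rw [one_div, ← div_eq_mul_inv] at h2
  have := ENNReal.div_le_iff (by norm_num) (by norm_num) |>.1 h2
  exact this.trans (by norm_num)

end Poincare

/-! ### Uniform deviations of an isonormal process -/

section Deviations

variable {Ω H : Type*} [MeasurableSpace Ω] {P : Measure Ω}
  [NormedAddCommGroup H] [InnerProductSpace ℝ H] {W : H → Ω → ℝ}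

theorem IsIsonormal.hasGaussianLaw_toLp (hW : IsIsonormal W P) {n : ℕ} (e : Fin n → H) :
    HasGaussianLaw (fun ω => WithLp.toLp 2 (fun k => W (e k) ω) : Ω → EuclideanSpace ℝ (Fin n))
      P := by
  have h := (hW.gaussian.comp_right e).hasGaussianLaw Finset.univ
  let L : (↥(Finset.univ : Finset (Fin n)) → ℝ) →L[ℝ] (Fin n → ℝ) :=
    ContinuousLinearMap.pi fun k => ContinuousLinearMap.proj ⟨k, Finset.mem_univ k⟩
  exact HasGaussianLaw.toLp_pi (X := fun k ω => W (e k) ω) 2 (h.map L)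

/-- The Gaussian tail bound. The variance is `‖h‖²`, which is at most `1`. -/
theorem IsIsonormal.measure_abs_gt_le [IsProbabilityMeasure P] (hW : IsIsonormal W P) {h : H}
    (hh : ‖h‖ ≤ 1) {t : ℝ} (ht : 0 ≤ t) :
    P {ω | t < |W h ω|} ≤ ENNReal.ofReal (2 * Real.exp (-t ^ 2 / 2)) := by
  have hg : HasGaussianLaw (W h) P := hW.gaussian.hasGaussianLaw_eval h
  have hvar : Var[W h; P] ≤ 1 := by
    rw [variance_eq_sub hg.memLp_two, hW.centered]
    have := hW.covariance h h
    rw [real_inner_self_eq_norm_sq] at this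
    simp only [Pi.pow_apply, pow_two] at this ⊢
    rw [this]
    nlinarith [norm_nonneg h]
  have hlaw : P.map (W h) = gaussianReal 0 (Var[W h; P]).toNNReal := by
    rw [hg.map_eq_gaussianReal, hW.centered]
  have hsub : HasSubgaussianMGF (W h) 1 P := by
    refine ⟨fun s => ?_, fun s => ?_⟩
    · have := integrable_exp_mul_gaussianReal (μ := 0) (v := (Var[W h; P]).toNNReal) s
      rw [← hlaw] at this
      exact this.comp_aemeasurable hg.aemeasurable
    · rw [mgf_gaussianReal hlaw]
      refine Real.exp_le_exp.2 ?_
      have : ((Var[W h; P]).toNNReal : ℝ) ≤ 1 := by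
        rw [Real.coe_toNNReal _ (variance_nonneg _ _)]; exact hvar
      have : ((Var[W h; P]).toNNReal : ℝ) * s ^ 2 ≤ 1 * s ^ 2 := by gcongr
      simp only [NNReal.coe_one]
      linarith
  have h1 := hsub.measure_ge_le ht
  have h2 := hsub.neg.measure_ge_le ht
  rw [← ofReal_measureReal]
  refine ENNReal.ofReal_le_ofReal ?_
  have hs : {ω | t < |W h ω|} ⊆ {ω | t ≤ W h ω} ∪ {ω | t ≤ (-W h) ω} := by
    intro ω hω
    rcases lt_abs.1 (show t < |W h ω| from hω) with h | h
    · exact Or.inl h.le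
    · exact Or.inr h.le
  refine (measureReal_mono hs).trans ((measureReal_union_le _ _).trans ?_)
  simp only [NNReal.coe_one, mul_one] at h1 h2
  linarith

/-- If with probability at least `1/4` no `|W(ψ_i)|` exceeds `τ_i`, then the noise is bounded on the
whole span of the `ψ_i`, up to a term `D ω * ‖·‖` where `D` is the distance of a Gaussian vector to
the convex set defined by these constraints. -/
theorem exists_deviation_bound [IsProbabilityMeasure P] (hW : IsIsonormal W P) {V₀ : Submodule ℝ H}
    (hL : HasLinearPathsOn W V₀ P) {ι : Type*} [Fintype ι] {ψ : ι → H} (hψ : ∀ i, ψ i ∈ V₀)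
    {τ : ι → ℝ} (hτ : ∀ i, 0 ≤ τ i) (hP : ∑ i, P {ω | τ i < |W (ψ i) ω|} ≤ 3 / 4) :
    ∃ D : Ω → ℝ, ∫⁻ ω, ENNReal.ofReal (D ω ^ 2) ∂P ≤ 24 ∧
      ∀ᵐ ω ∂P, ∀ θ : ι → ℝ,
        W (∑ i, θ i • ψ i) ω ≤ ∑ i, τ i * |θ i| + D ω * ‖∑ i, θ i • ψ i‖ := by
  let V : Submodule ℝ H := Submodule.span ℝ (Set.range ψ)
  have hV : V ≤ V₀ := Submodule.span_le.2 (Set.range_subset_iff.2 hψ)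
  have : FiniteDimensional ℝ V := FiniteDimensional.span_of_finite ℝ (Set.finite_range ψ)
  obtain ⟨n, ⟨b⟩⟩ : ∃ n, Nonempty (OrthonormalBasis (Fin n) ℝ V) :=
    ⟨_, ⟨stdOrthonormalBasis ℝ V⟩⟩
  let E := EuclideanSpace ℝ (Fin n)
  let w : Ω → E := fun ω => WithLp.toLp 2 fun k => W (b k) ω
  have hwG : HasGaussianLaw w P := hW.hasGaussianLaw_toLp _
  have hwm : AEMeasurable w P := hwG.aemeasurable
  -- `w` represents `W` on `V`, in the coordinates of the orthonormal basis `b`.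
  have hpath : ∀ᵐ ω ∂P, ∀ u : E, W (b.repr.symm u : V) ω = ⟪u, w ω⟫ := by
    filter_upwards [hL] with ω hω u
    obtain ⟨L, hLω⟩ := hω
    have h1 : ∀ v : V, W v ω = (L ∘ₗ Submodule.inclusion hV) v := fun v => hLω ⟨v, hV v.2⟩
    rw [h1, ← OrthonormalBasis.sum_repr_symm, map_sum, PiLp.inner_apply]
    refine Finset.sum_congr rfl fun k _ => ?_
    rw [map_smul, ← h1]
    simp [w, mul_comm]
  let μ : Measure E := P.map w
  have hμG : IsGaussian μ := hwG.isGaussian_map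
  have hcov : ∀ u : E, ∫ y, ⟪u, y⟫ ^ 2 ∂μ = ‖u‖ ^ 2 := by
    intro u
    rw [integral_map hwm (by fun_prop)]
    have h1 : (fun ω => ⟪u, w ω⟫ ^ 2) =ᵐ[P]
        fun ω => W (b.repr.symm u : V) ω * W (b.repr.symm u : V) ω := by
      filter_upwards [hpath] with ω hω
      rw [hω, pow_two]
    rw [integral_congr_ae h1, hW.covariance, real_inner_self_eq_norm_sq, ← Submodule.coe_norm,
      LinearIsometryEquiv.norm_map]
  have hcent : μ[id] = 0 := by
    refine ext_inner_left ℝ fun u => ?_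
    rw [← integral_inner IsGaussian.integrable_id, inner_zero_right,
      integral_map hwm (by fun_prop)]
    have h1 : (fun ω => ⟪u, id (w ω)⟫) =ᵐ[P] fun ω => W (b.repr.symm u : V) ω := by
      filter_upwards [hpath] with ω hω
      rw [hω, id]
    rw [integral_congr_ae h1, hW.centered]
  let χ : ι → V := fun i => ⟨ψ i, Submodule.subset_span ⟨i, rfl⟩⟩
  let K : Set E := {v | ∀ i, |⟪b.repr (χ i), v⟫| ≤ τ i}
  have hKe : K = ⋂ i, {v | |⟪b.repr (χ i), v⟫| ≤ τ i} := by
    ext v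
    rw [Set.mem_iInter]
    rfl
  have hKcl : IsClosed K := by
    rw [hKe]
    exact isClosed_iInter fun i => isClosed_le (by fun_prop) continuous_const
  have hKcv : Convex ℝ K := by
    rw [hKe]
    refine convex_iInter fun i => ?_
    have h1 : {v : E | |⟪b.repr (χ i), v⟫| ≤ τ i}
        = (innerSL ℝ (b.repr (χ i))) ⁻¹' Set.Icc (-τ i) (τ i) := by
      ext v; simp [abs_le]
    rw [h1]
    exact (convex_Icc _ _).linear_preimage (innerSL ℝ (b.repr (χ i))).toLinearMap
  have hK0 : (0 : E) ∈ K := fun i => by simpa using hτ i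
  obtain ⟨π, hπ⟩ := exists_projection ⟨0, hK0⟩ hKcl hKcv
  have hμP : IsProbabilityMeasure μ := Measure.isProbabilityMeasure_map hwm
  have hKc : μ Kᶜ ≤ 3 / 4 := by
    rw [Measure.map_apply_of_aemeasurable hwm hKcl.measurableSet.compl]
    refine (le_trans ?_ (measure_iUnion_fintype_le P fun i => {ω | τ i < |W (ψ i) ω|})).trans hP
    refine measure_mono_ae ?_
    filter_upwards [hpath] with ω hω hmem
    have hmem' : ¬ ∀ i, |⟪b.repr (χ i), w ω⟫| ≤ τ i := hmem
    push Not at hmem'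
    obtain ⟨i, hi⟩ := hmem'
    have := hω (b.repr (χ i))
    rw [LinearIsometryEquiv.symm_apply_apply] at this
    rw [← this] at hi
    exact Set.mem_iUnion.2 ⟨i, hi⟩
  have hK : 1 / 4 ≤ μ K := by
    have h1 : (1 : ENNReal) ≤ μ K + 3 / 4 := by
      rw [← prob_add_prob_compl (μ := μ) hKcl.measurableSet]
      gcongr
    have h2 : (1 : ENNReal) = 1 / 4 + 3 / 4 := by
      rw [← ENNReal.add_div, show (1 + 3 : ENNReal) = 4 by norm_num,
        ENNReal.div_self (by norm_num) (by norm_num)]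
    rw [h2] at h1
    exact (ENNReal.add_le_add_iff_right (by finiteness)).1 h1
  have hπm : Measurable π := (continuous_projection hπ).measurable
  refine ⟨fun ω => ‖w ω - π (w ω)‖, ?_, ?_⟩
  · have := lintegral_sq_norm_sub_projection_le hcent hcov hπ hKcl.measurableSet hK
    rwa [lintegral_map' (by fun_prop) hwm] at this
  · filter_upwards [hpath] with ω hω θ
    let v : V := ∑ i, θ i • χ i
    have hv : (v : H) = ∑ i, θ i • ψ i := by simp [v, χ]
    have h1 := hω (b.repr v)
    rw [LinearIsometryEquiv.symm_apply_apply, hv] at h1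
    have hnorm : ‖b.repr v‖ = ‖∑ i, θ i • ψ i‖ := by
      rw [LinearIsometryEquiv.norm_map, Submodule.coe_norm, hv]
    have h2 : ⟪b.repr v, π (w ω)⟫ ≤ ∑ i, τ i * |θ i| := by
      simp only [v, map_sum, map_smul, sum_inner, real_inner_smul_left]
      refine Finset.sum_le_sum fun i _ => ?_
      calc θ i * ⟪b.repr (χ i), π (w ω)⟫ ≤ |θ i * ⟪b.repr (χ i), π (w ω)⟫| := le_abs_self _
        _ = |⟪b.repr (χ i), π (w ω)⟫| * |θ i| := by rw [abs_mul, mul_comm]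
        _ ≤ τ i * |θ i| := by
          gcongr
          exact (hπ (w ω)).1 i
    have h3 : ⟪b.repr v, w ω - π (w ω)⟫ ≤ ‖w ω - π (w ω)‖ * ‖∑ i, θ i • ψ i‖ := by
      rw [← hnorm, mul_comm]
      exact real_inner_le_norm _ _
    rw [inner_sub_right] at h3
    rw [h1]
    linarith

end Deviations

/-! ### Thresholds for the noise -/

section Thresholds

/-- The threshold `7/4 (√(ln (j + 1)) + 1)` for the noise `|W(φ_j)|` at the dictionary element of
index `j`. The factor `7/4` is less than `2`, so that only `7/8` of `λ_p` is spent on the noise, and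
more than `√3`, so that the tails `exp(-τ_j²/2)` are summable with a small sum. -/
def thr (j : ℕ) : ℝ := 7 / 4 * (Real.sqrt (Real.log (j + 1)) + 1)

theorem thr_nonneg (j : ℕ) : 0 ≤ thr j := by unfold thr; positivity

theorem two_mul_thr_le_lam {ε : ℝ} (hε : 0 < ε) {j p : ℕ} (hjp : j < p) :
    2 * ε * thr j ≤ 7 / 8 * lam ε p := by
  have h1 : Real.log (j + 1) ≤ Real.log p := by
    refine Real.log_le_log (by positivity) ?_
    exact_mod_cast hjp
  have h2 := Real.sqrt_le_sqrt h1
  unfold thr lam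
  nlinarith

theorem sum_inv_mul_sqrt_le (n : ℕ) :
    ∑ j ∈ Finset.range n, 1 / (((j : ℝ) + 2) * Real.sqrt (j + 2)) ≤ 2 := by
  have h : ∀ j : ℕ, 1 / (((j : ℝ) + 2) * Real.sqrt (j + 2))
      ≤ 2 / Real.sqrt (j + 1) - 2 / Real.sqrt ((j + 1 : ℕ) + 1) := by
    intro j
    have e : (((j + 1 : ℕ) : ℝ) + 1) = j + 2 := by push_cast; ring
    rw [e]
    have ha : 0 < Real.sqrt ((j : ℝ) + 1) := Real.sqrt_pos.2 (by positivity)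
    have hab : Real.sqrt ((j : ℝ) + 1) ≤ Real.sqrt (j + 2) := Real.sqrt_le_sqrt (by linarith)
    have ha2 : Real.sqrt ((j : ℝ) + 1) ^ 2 = j + 1 := Real.sq_sqrt (by positivity)
    have hb2 : Real.sqrt ((j : ℝ) + 2) ^ 2 = j + 2 := Real.sq_sqrt (by positivity)
    set a := Real.sqrt ((j : ℝ) + 1)
    set b := Real.sqrt ((j : ℝ) + 2)
    have hb : 0 < b := ha.trans_le hab
    have hd : (b - a) * (b + a) = 1 := by nlinarith
    rw [← hb2, div_sub_div _ _ ha.ne' hb.ne', div_le_div_iff₀ (by positivity) (by positivity)]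
    have h1 : 1 ≤ (b - a) * (2 * b) := by nlinarith
    have h2 : a * b ≤ b ^ 2 := by nlinarith
    have h3 : b ^ 2 ≤ b ^ 2 * ((b - a) * (2 * b)) := le_mul_of_one_le_right (by positivity) h1
    nlinarith
  calc ∑ j ∈ Finset.range n, 1 / (((j : ℝ) + 2) * Real.sqrt (j + 2))
      ≤ ∑ j ∈ Finset.range n, (2 / Real.sqrt (j + 1) - 2 / Real.sqrt ((j + 1 : ℕ) + 1)) :=
        Finset.sum_le_sum fun j _ => h j
    _ = 2 / Real.sqrt ((0 : ℕ) + 1) - 2 / Real.sqrt (n + 1) := by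
        rw [Finset.sum_range_sub' (fun j : ℕ => 2 / Real.sqrt ((j : ℝ) + 1))]
    _ ≤ 2 := by simp; positivity

theorem exp_neg_thr_zero : Real.exp (-thr 0 ^ 2 / 2) ≤ 0.2233 := by
  have h : Real.exp (-1) < 0.3679 := by
    have := Real.exp_neg_one_lt_d9; linarith
  have h2 : Real.exp (-thr 0 ^ 2 / 2) ^ 2 ≤ 0.2233 ^ 2 := by
    rw [← Real.exp_nat_mul]
    calc Real.exp ((2 : ℕ) * (-thr 0 ^ 2 / 2)) ≤ Real.exp ((3 : ℕ) * (-1)) := by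
          refine Real.exp_le_exp.2 ?_
          simp [thr]
          norm_num
      _ = Real.exp (-1) ^ 3 := Real.exp_nat_mul _ _
      _ ≤ 0.3679 ^ 3 := by gcongr
      _ ≤ 0.2233 ^ 2 := by norm_num
  exact le_of_sq_le_sq h2 (by norm_num)

theorem exp_neg_thr_succ (j : ℕ) :
    Real.exp (-thr (j + 1) ^ 2 / 2) ≤ 0.05 * (1 / (((j : ℝ) + 2) * Real.sqrt (j + 2))) := by
  have hpos : (0 : ℝ) < (j : ℝ) + 2 := by positivity
  have hlog : Real.log 2 ≤ Real.log ((j : ℝ) + 2) :=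
    Real.log_le_log (by norm_num) (by linarith [(Nat.cast_nonneg j : (0 : ℝ) ≤ j)])
  have hl2 := Real.log_two_gt_d9
  have hs : 0.8 ≤ Real.sqrt (Real.log ((j : ℝ) + 2)) :=
    Real.le_sqrt_of_sq_le (by norm_num; linarith)
  have hsq : Real.sqrt (Real.log ((j : ℝ) + 2)) ^ 2 = Real.log ((j : ℝ) + 2) :=
    Real.sq_sqrt (by linarith)
  have e : ((j + 1 : ℕ) : ℝ) + 1 = j + 2 := by push_cast; ring
  have h3 : Real.exp (-3) ≤ 0.05 := by
    have : Real.exp (-1) < 0.3679 := by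
      have := Real.exp_neg_one_lt_d9; linarith
    calc Real.exp (-3) = Real.exp (-1) ^ 3 := by rw [← Real.exp_nat_mul]; norm_num
      _ ≤ 0.3679 ^ 3 := by gcongr
      _ ≤ 0.05 := by norm_num
  have h4 : Real.exp (-(3 / 2 * Real.log ((j : ℝ) + 2)))
      = 1 / (((j : ℝ) + 2) * Real.sqrt (j + 2)) := by
    rw [Real.exp_neg, one_div, Real.sqrt_eq_rpow, ← Real.rpow_one_add' hpos.le (by norm_num),
      Real.rpow_def_of_pos hpos]
    norm_num [mul_comm]
  calc Real.exp (-thr (j + 1) ^ 2 / 2)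
      ≤ Real.exp (-3 + -(3 / 2 * Real.log ((j : ℝ) + 2))) := by
        refine Real.exp_le_exp.2 ?_
        rw [thr, e]
        nlinarith
    _ ≤ 0.05 * (1 / (((j : ℝ) + 2) * Real.sqrt (j + 2))) := by
        rw [Real.exp_add, h4]
        gcongr

/-- The union bound for the dictionary with thresholds `thr j`, and one more vector, the competitor,
with threshold `3`. -/
theorem sum_exp_neg_thr_le (n : ℕ) :
    2 * Real.exp (-3 ^ 2 / 2) + ∑ j ∈ Finset.range n, 2 * Real.exp (-thr j ^ 2 / 2) ≤ 3 / 4 := by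
  have h3 : Real.exp (-3 ^ 2 / 2) ≤ 0.02 := by
    have : Real.exp (-1) < 0.3679 := by
      have := Real.exp_neg_one_lt_d9; linarith
    calc Real.exp (-3 ^ 2 / 2) ≤ Real.exp ((4 : ℕ) * (-1)) := by
          refine Real.exp_le_exp.2 ?_
          norm_num
      _ = Real.exp (-1) ^ 4 := Real.exp_nat_mul _ _
      _ ≤ 0.3679 ^ 4 := by gcongr
      _ ≤ 0.02 := by norm_num
  have hn : ∑ j ∈ Finset.range n, 2 * Real.exp (-thr j ^ 2 / 2)
      ≤ ∑ j ∈ Finset.range (n + 1), 2 * Real.exp (-thr j ^ 2 / 2) := by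
    rw [Finset.sum_range_succ]
    exact le_add_of_nonneg_right (by positivity)
  have hsum : ∑ j ∈ Finset.range n, 2 * Real.exp (-thr (j + 1) ^ 2 / 2) ≤ 0.2 := by
    calc ∑ j ∈ Finset.range n, 2 * Real.exp (-thr (j + 1) ^ 2 / 2)
        ≤ ∑ j ∈ Finset.range n, 0.1 * (1 / (((j : ℝ) + 2) * Real.sqrt (j + 2))) := by
          refine Finset.sum_le_sum fun j _ => ?_
          have := exp_neg_thr_succ j
          linarith
      _ = 0.1 * ∑ j ∈ Finset.range n, 1 / (((j : ℝ) + 2) * Real.sqrt (j + 2)) := by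
          rw [Finset.mul_sum]
      _ ≤ 0.1 * 2 := by gcongr; exact sum_inv_mul_sqrt_le n
      _ ≤ 0.2 := by norm_num
  rw [Finset.sum_range_succ'] at hn
  have h0 := exp_neg_thr_zero
  linarith

end Thresholds

/-! ### The `ℓ₁`-norm of a truncated dictionary -/

section L1Norm

variable {H : Type*} [NormedAddCommGroup H] [InnerProductSpace ℝ H] {φ : ℕ → H} {p : ℕ}

theorem mem_spanTrunc_iff {h : H} :
    h ∈ spanTrunc φ p ↔ ∃ θ : Fin p → ℝ, h = ∑ j, θ j • φ j := by
  have e : φ '' Set.Iio p = Set.range fun j : Fin p => φ j := by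
    ext x
    constructor
    · rintro ⟨j, hj, rfl⟩
      exact ⟨⟨j, hj⟩, rfl⟩
    · rintro ⟨j, rfl⟩
      exact ⟨j, j.2, rfl⟩
  rw [spanTrunc, e, Submodule.mem_span_range_iff_exists_fun]
  simp only [eq_comm]

theorem l1Norm_le (θ : Fin p → ℝ) : l1Norm φ p (∑ j, θ j • φ j) ≤ ∑ j, |θ j| :=
  csInf_le ⟨0, by rintro r ⟨θ, -, rfl⟩; positivity⟩ ⟨θ, rfl, rfl⟩

theorem le_l1Norm {h : H} (hh : h ∈ spanTrunc φ p) {c : ℝ}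
    (hc : ∀ θ : Fin p → ℝ, h = ∑ j, θ j • φ j → c ≤ ∑ j, |θ j|) : c ≤ l1Norm φ p h := by
  obtain ⟨θ, hθ⟩ := mem_spanTrunc_iff.1 hh
  refine le_csInf ⟨_, θ, hθ, rfl⟩ ?_
  rintro r ⟨θ, hθ, rfl⟩
  exact hc θ hθ

theorem l1Norm_nonneg (φ : ℕ → H) (p : ℕ) (h : H) : 0 ≤ l1Norm φ p h :=
  Real.sInf_nonneg (by rintro r ⟨θ, -, rfl⟩; positivity)

theorem norm_le_l1Norm (hφ : ∀ j, ‖φ j‖ ≤ 1) {h : H} (hh : h ∈ spanTrunc φ p) :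
    ‖h‖ ≤ l1Norm φ p h := by
  refine le_l1Norm hh fun θ hθ => ?_
  rw [hθ]
  refine (norm_sum_le _ _).trans (Finset.sum_le_sum fun j _ => ?_)
  rw [norm_smul, Real.norm_eq_abs]
  exact mul_le_of_le_one_right (abs_nonneg _) (hφ j)

theorem l1Norm_add_le {g h : H} (hg : g ∈ spanTrunc φ p) (hh : h ∈ spanTrunc φ p) :
    l1Norm φ p (g + h) ≤ l1Norm φ p g + l1Norm φ p h := by
  suffices l1Norm φ p (g + h) - l1Norm φ p h ≤ l1Norm φ p g by linarith
  refine le_l1Norm hg fun θ hθ => ?_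
  suffices l1Norm φ p (g + h) - ∑ j, |θ j| ≤ l1Norm φ p h by linarith
  refine le_l1Norm hh fun η hη => ?_
  have e : g + h = ∑ j, (θ j + η j) • φ j := by
    simp only [add_smul, Finset.sum_add_distrib, ← hθ, ← hη]
  have h1 : ∑ j, |θ j + η j| ≤ ∑ j, |θ j| + ∑ j, |η j| := by
    rw [← Finset.sum_add_distrib]
    exact Finset.sum_le_sum fun j _ => abs_add_le _ _
  have h2 := l1Norm_le (φ := φ) fun j => θ j + η j
  rw [← e] at h2
  linarith

theorem l1Norm_smul_le (c : ℝ) {h : H} (hh : h ∈ spanTrunc φ p) :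
    l1Norm φ p (c • h) ≤ |c| * l1Norm φ p h := by
  rcases eq_or_ne c 0 with rfl | hc
  · have := l1Norm_le (φ := φ) (p := p) 0
    simpa using this
  · have hc' : 0 < |c| := abs_pos.2 hc
    rw [← div_le_iff₀' hc']
    refine le_l1Norm hh fun θ hθ => ?_
    rw [div_le_iff₀' hc', hθ, Finset.smul_sum, Finset.mul_sum]
    have := l1Norm_le (φ := φ) fun j => c * θ j
    simpa only [mul_smul, abs_mul] using this

/-- The `ℓ₁`-norm as a seminorm on the span of the truncated dictionary. -/
def l1Seminorm (φ : ℕ → H) (p : ℕ) : Seminorm ℝ (spanTrunc φ p) :=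
  Seminorm.ofSMulLE (fun h => l1Norm φ p h)
    (le_antisymm (by simpa using l1Norm_le (φ := φ) (p := p) 0) (l1Norm_nonneg φ p _))
    (fun g h => l1Norm_add_le g.2 h.2) (fun c h => l1Norm_smul_le c h.2)

instance finiteDimensional_spanTrunc (φ : ℕ → H) (p : ℕ) :
    FiniteDimensional ℝ (spanTrunc φ p) :=
  FiniteDimensional.span_of_finite ℝ ((Set.finite_Iio p).image φ)

/-- `l1Norm φ p` itself is `0` off the span, hence not continuous on `H` in general; it is replaced
by a continuous function which agrees with it on the span. -/
theorem exists_continuous_eq_l1Norm (φ : ℕ → H) (p : ℕ) :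
    ∃ F : H → ℝ, Continuous F ∧ ∀ h ∈ spanTrunc φ p, F h = l1Norm φ p h := by
  have hc : Continuous (l1Seminorm φ p) := by
    rw [← continuousOn_univ]
    exact (l1Seminorm φ p).convexOn.continuousOn isOpen_univ
  refine ⟨fun h => l1Seminorm φ p ((spanTrunc φ p).orthogonalProjectionOnto h),
    by fun_prop, fun h hh => ?_⟩
  have := Submodule.orthogonalProjectionOnto_mem_subspace_eq_self (K := spanTrunc φ p) ⟨h, hh⟩
  simp only [this]
  rfl

end L1Norm

/-! ### Pathwise bound of the loss -/

/-- A family indexed by `Fin q` extended by zero to `Fin N` has the same sum. -/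
theorem sum_fin_dite_lt {M : Type*} [AddCommMonoid M] {q N : ℕ} (hqN : q ≤ N) (f : Fin q → M) :
    ∑ j : Fin N, (if hj : (j : ℕ) < q then f ⟨j, hj⟩ else 0) = ∑ j, f j := by
  let G : ℕ → M := fun k => if hk : k < q then f ⟨k, hk⟩ else 0
  have h1 : ∑ j, f j = ∑ j : Fin q, G j :=
    Finset.sum_congr rfl fun j _ => by simp [G]
  rw [h1, Fin.sum_univ_eq_sum_range G q]
  rw [show ∑ j : Fin N, (if hj : (j : ℕ) < q then f ⟨j, hj⟩ else 0) = ∑ j : Fin N, G j from rfl,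
    Fin.sum_univ_eq_sum_range G N]
  refine (Finset.sum_subset (Finset.range_mono hqN) fun k _ hk => ?_).symm
  simp only [Finset.mem_range] at hk
  simp [G, hk]

section Oracle

variable {Ω H : Type*} [MeasurableSpace Ω] {P : Measure Ω}
  [NormedAddCommGroup H] [InnerProductSpace ℝ H] {W : H → Ω → ℝ} {φ : ℕ → H}

theorem spanTrunc_le_spanDict (φ : ℕ → H) (p : ℕ) : spanTrunc φ p ≤ spanDict φ :=
  Submodule.span_mono (Set.image_subset_range _ _)

theorem lam_nonneg {ε : ℝ} (hε : 0 < ε) (p : ℕ) : 0 ≤ lam ε p := by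
  unfold lam; positivity

theorem pen_nonneg (ε : ℝ) (p : ℕ) : 0 ≤ pen ε p :=
  mul_nonneg (by positivity) (Real.log_natCast_nonneg p)

/-- The increments `W(g) - W(h)` between a fixed `h` and all `g` of level at most `N`. Both the bound
of `D` and the constants in front of the norms are free of `N`. As `h` enters as one more element of
the dictionary, its contribution `6 ε ‖h‖` does not grow with the level of `g`. -/
theorem exists_noise_bound [IsProbabilityMeasure P] (hW : IsIsonormal W P)
    (hL : HasLinearPathsOn W (spanDict φ) P) (hφ : ∀ j, ‖φ j‖ ≤ 1) {ε : ℝ} (hε : 0 < ε) {h : H}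
    (hh : h ∈ spanDict φ) (N : ℕ) :
    ∃ D : Ω → ℝ, ∫⁻ ω, ENNReal.ofReal (D ω ^ 2) ∂P ≤ 24 ∧
      ∀ᵐ ω ∂P, ∀ q ≤ N, ∀ g ∈ spanTrunc φ q,
        2 * ε * (W g ω - W h ω)
          ≤ 7 / 8 * (lam ε q * l1Norm φ q g) + 6 * ε * ‖h‖ + 2 * ε * D ω * ‖g - h‖ := by
  -- If `h = 0` then `‖h‖⁻¹ • h = 0`, which satisfies all that is needed.
  let ψ : Option (Fin N) → H := fun o => o.elim (‖h‖⁻¹ • h) fun j => φ j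
  let τ : Option (Fin N) → ℝ := fun o => o.elim 3 fun j => thr j
  have hψ : ∀ o, ψ o ∈ spanDict φ := by
    rintro (_ | j)
    · exact (spanDict φ).smul_mem _ hh
    · exact Submodule.subset_span ⟨j, rfl⟩
  have hψ1 : ∀ o, ‖ψ o‖ ≤ 1 := by
    rintro (_ | j)
    · simp only [ψ, Option.elim, norm_smul, norm_inv, norm_norm]
      exact inv_mul_le_one
    · exact hφ j
  have hτ : ∀ o, 0 ≤ τ o := by
    rintro (_ | j)
    · simp [τ]
    · exact thr_nonneg j
  have hP : ∑ o, P {ω | τ o < |W (ψ o) ω|} ≤ 3 / 4 := by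
    calc ∑ o, P {ω | τ o < |W (ψ o) ω|}
        ≤ ∑ o, ENNReal.ofReal (2 * Real.exp (-τ o ^ 2 / 2)) :=
          Finset.sum_le_sum fun o _ => hW.measure_abs_gt_le (hψ1 o) (hτ o)
      _ = ENNReal.ofReal (∑ o, 2 * Real.exp (-τ o ^ 2 / 2)) :=
          (ENNReal.ofReal_sum_of_nonneg fun _ _ => by positivity).symm
      _ ≤ ENNReal.ofReal (3 / 4) := by
          refine ENNReal.ofReal_le_ofReal ?_
          rw [Fintype.sum_option]
          refine le_trans (le_of_eq ?_) (sum_exp_neg_thr_le N)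
          rw [← Fin.sum_univ_eq_sum_range fun j => 2 * Real.exp (-thr j ^ 2 / 2)]
          rfl
      _ = 3 / 4 := by
          rw [ENNReal.ofReal_div_of_pos (by norm_num)]
          norm_num
  obtain ⟨D, hD, hdev⟩ := exists_deviation_bound hW hL hψ hτ hP
  refine ⟨D, hD, ?_⟩
  filter_upwards [hdev, hL] with ω hω hlin q hqN g hg
  have hgD : g ∈ spanDict φ := spanTrunc_le_spanDict φ q hg
  have hsub : W (g - h) ω = W g ω - W h ω := by
    obtain ⟨L, hLω⟩ := hlin
    have h1 := hLω (⟨g, hgD⟩ - ⟨h, hh⟩)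
    rw [map_sub, ← hLω, ← hLω] at h1
    exact h1
  have hh1 : ‖h‖ • (‖h‖⁻¹ • h) = h := by
    rcases eq_or_ne h 0 with rfl | h0
    · simp
    · rw [smul_inv_smul₀ (norm_ne_zero_iff.2 h0)]
  have hlam := lam_nonneg hε q
  suffices hmain : ∀ η : Fin q → ℝ, g = ∑ j, η j • φ j →
      2 * ε * (W g ω - W h ω) - 6 * ε * ‖h‖ - 2 * ε * D ω * ‖g - h‖
        ≤ 7 / 8 * lam ε q * ∑ j, |η j| by
    have hlam' : 0 < 7 / 8 * lam ε q := by unfold lam; positivity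
    have := le_l1Norm hg fun η hη => (div_le_iff₀' hlam').2 (hmain η hη)
    rw [div_le_iff₀' hlam'] at this
    linarith
  intro η hη
  let θ : Option (Fin N) → ℝ := fun o =>
    o.elim (-‖h‖) fun j => if hj : (j : ℕ) < q then η ⟨j, hj⟩ else 0
  have hθ : ∑ o, θ o • ψ o = g - h := by
    rw [Fintype.sum_option, hη, ← sum_fin_dite_lt hqN]
    simp only [θ, ψ, Option.elim, neg_smul, hh1, dite_smul, zero_smul]
    abel
  have hτθ : 2 * ε * ∑ o, τ o * |θ o| ≤ 6 * ε * ‖h‖ + 7 / 8 * lam ε q * ∑ j, |η j| := by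
    have h1 : ∑ j : Fin N, thr j * |if hj : (j : ℕ) < q then η ⟨j, hj⟩ else 0|
        = ∑ j : Fin q, thr j * |η j| := by
      rw [← sum_fin_dite_lt hqN]
      refine Finset.sum_congr rfl fun j _ => ?_
      split_ifs <;> simp
    have h2 : 2 * ε * ∑ j : Fin q, thr j * |η j| ≤ 7 / 8 * lam ε q * ∑ j, |η j| := by
      rw [Finset.mul_sum, Finset.mul_sum]
      refine Finset.sum_le_sum fun j _ => ?_
      rw [← mul_assoc]
      exact mul_le_mul_of_nonneg_right (two_mul_thr_le_lam hε j.2) (abs_nonneg _)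
    rw [Fintype.sum_option]
    simp only [θ, τ, Option.elim, abs_neg, abs_norm]
    rw [h1]
    linarith
  have := hω θ
  rw [hθ, hsub] at this
  nlinarith

/-- The deterministic part of the argument. Here `g` is the selected estimator, `h` the competitor,
`w` and `v` are the values of the noise at `g` and `h`, the letters `B`, `b` stand for the
`ℓ₁`-penalties and `C`, `c` for the penalties of the levels. -/
theorem loss_le_of_noise_le {f g h : H} {ε D b B c C w v : ℝ}
    (hc : 0 ≤ c) (hC : 0 ≤ C) (hε : 0 ≤ ε)
    (hsel : -2 * (⟪f, g⟫ + ε * w) + ‖g‖ ^ 2 + B + C ≤ -2 * (⟪f, h⟫ + ε * v) + ‖h‖ ^ 2 + b + c)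
    (hnoise : 2 * ε * (w - v) ≤ 7 / 8 * B + 3 / 2 * b + 2 * ε * D * ‖g - h‖) :
    ‖f - g‖ ^ 2 + B + C ≤ 20 * (‖f - h‖ ^ 2 + b + c) + 24 * ε ^ 2 * D ^ 2 := by
  have h1 := norm_sub_sq_real f g
  have h2 := norm_sub_sq_real f h
  have h3 : ‖g - h‖ ≤ ‖f - g‖ + ‖f - h‖ := by
    have := norm_sub_le_norm_sub_add_norm_sub g f h
    rwa [norm_sub_rev g f] at this
  have h4 : 2 * ε * D * ‖g - h‖ ≤ 2 * (ε * |D|) * (‖f - g‖ + ‖f - h‖) := by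
    have : ε * D ≤ ε * |D| := by gcongr; exact le_abs_self D
    calc 2 * ε * D * ‖g - h‖ = 2 * (ε * D) * ‖g - h‖ := by ring
      _ ≤ 2 * (ε * |D|) * ‖g - h‖ := by gcongr
      _ ≤ _ := by gcongr
  have h5 : (ε * |D|) ^ 2 = ε ^ 2 * D ^ 2 := by rw [mul_pow, sq_abs]
  generalize ε * |D| = d at *
  nlinarith [sq_nonneg (‖f - g‖ - 2 * d), sq_nonneg (‖f - h‖ - d), sq_nonneg ‖f - h‖]

end Oracle

/-! ### Measurability and integration -/

section Measurability

variable {Ω : Type*} [MeasurableSpace Ω] {P : Measure Ω}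

theorem aestronglyMeasurable_comp_countable {S : Set ℕ} {F : ℕ → Ω → ℝ} {X : Ω → ℕ}
    (hX : AEMeasurable X P) (hXS : ∀ᵐ ω ∂P, X ω ∈ S)
    (hF : ∀ p ∈ S, AEStronglyMeasurable (F p) P) :
    AEStronglyMeasurable (fun ω => F (X ω) ω) P := by
  classical
  let G : ℕ → Ω → ℝ := fun p => if hp : p ∈ S then (hF p hp).mk (F p) else 0
  have hG : ∀ p, Measurable (G p) := by
    intro p
    by_cases hp : p ∈ S
    · simpa only [G, hp, dif_pos] using (hF p hp).stronglyMeasurable_mk.measurable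
    · simpa only [G, hp, dif_neg, not_false_eq_true] using measurable_zero
  have hFG : ∀ᵐ ω ∂P, ∀ p, p ∈ S → F p ω = G p ω := by
    refine ae_all_iff.2 fun p => ?_
    by_cases hp : p ∈ S
    · filter_upwards [(hF p hp).ae_eq_mk] with ω hω _
      simpa only [G, hp, dif_pos] using hω
    · exact Filter.Eventually.of_forall fun ω h => absurd h hp
  have hm : Measurable fun ω => G (hX.mk X ω) ω :=
    (measurable_from_prod_countable_right (f := fun x : ℕ × Ω => G x.1 x.2) hG).comp
      (hX.measurable_mk.prodMk measurable_id)
  refine hm.aestronglyMeasurable.congr ?_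
  filter_upwards [hX.ae_eq_mk, hXS, hFG] with ω h1 h2 h3
  rw [← h1, h3 _ h2]

/-- Monotone convergence along the events `X ≤ N`. The bounds `G` may change with `N`. -/
theorem lintegral_le_of_forall_nat {X : Ω → ℕ} (hX : AEMeasurable X P) {g : Ω → ENNReal}
    {c : ENNReal} (h : ∀ N, ∃ G : Ω → ENNReal, (∀ᵐ ω ∂P, X ω ≤ N → g ω ≤ G ω) ∧
      ∫⁻ ω, G ω ∂P ≤ c) : ∫⁻ ω, g ω ∂P ≤ c := by
  let S : ℕ → Set Ω := fun N => {ω | hX.mk X ω ≤ N}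
  have hS : ∀ N, MeasurableSet (S N) := fun N => hX.measurable_mk (measurableSet_Iic (a := N))
  have hU : ⋃ N, S N = Set.univ :=
    Set.eq_univ_of_forall fun ω => Set.mem_iUnion.2 ⟨hX.mk X ω, le_refl (hX.mk X ω)⟩
  have hmono : Monotone S := fun N M hNM ω (hω : hX.mk X ω ≤ N) => hω.trans hNM
  rw [← setLIntegral_univ, ← hU, setLIntegral_iUnion_of_directed _ hmono.directed_le]
  refine iSup_le fun N => ?_
  obtain ⟨G, hG, hGc⟩ := h N
  refine le_trans ?_ ((setLIntegral_le_lintegral (S N) G).trans hGc)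
  refine setLIntegral_mono_ae' (hS N) ?_
  filter_upwards [hG, hX.ae_eq_mk] with ω h1 h2 h3
  exact h1 (h2.trans_le h3)

theorem integrable_and_integral_le_of_lintegral {L : Ω → ℝ} {c : ℝ} (hc : 0 ≤ c)
    (hL : AEStronglyMeasurable L P) (hL0 : 0 ≤ᵐ[P] L)
    (h : ∫⁻ ω, ENNReal.ofReal (L ω) ∂P ≤ ENNReal.ofReal c) :
    Integrable L P ∧ ∫ ω, L ω ∂P ≤ c := by
  refine ⟨⟨hL, (hasFiniteIntegral_iff_ofReal hL0).2 (h.trans_lt ENNReal.ofReal_lt_top)⟩, ?_⟩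
  rw [integral_eq_lintegral_of_nonneg_ae hL0 hL]
  exact ENNReal.toReal_le_of_le_ofReal hc h

end Measurability

end LassoSelection

end

theorem theorem4p2 :
    ∃ C : ℝ, 0 < C ∧
      ∀ (Ω : Type*) [MeasurableSpace Ω] (P : Measure Ω) [IsProbabilityMeasure P]
        (H : Type*) [NormedAddCommGroup H] [InnerProductSpace ℝ H] [CompleteSpace H]
        [TopologicalSpace.SeparableSpace H]
        (W : H → Ω → ℝ) (φ : ℕ → H) (f : H) (ε : ℝ) (fhat : ℕ → Ω → H) (phat : Ω → ℕ),
        LassoSelection.IsIsonormal W P →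
        LassoSelection.HasLinearPathsOn W (LassoSelection.spanDict φ) P →
        (∀ j, ‖φ j‖ ≤ 1) →
        0 < ε →
        (∀ p ∈ LassoSelection.dyadic, AEStronglyMeasurable (fhat p) P) →
        AEMeasurable phat P →
        (∀ p ∈ LassoSelection.dyadic, ∀ᵐ ω ∂P,
          LassoSelection.IsLasso φ ε (fun h => LassoSelection.obs f ε W h ω) p (fhat p ω)) →
        (∀ᵐ ω ∂P,
          LassoSelection.IsSelected φ ε (fun h => LassoSelection.obs f ε W h ω)
            (fun p => fhat p ω) (phat ω)) →
        Integrable (fun ω => ‖f - fhat (phat ω) ω‖ ^ 2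
            + LassoSelection.lam ε (phat ω)
              * LassoSelection.l1Norm φ (phat ω) (fhat (phat ω) ω)
            + LassoSelection.pen ε (phat ω)) P ∧
        ∫ ω, (‖f - fhat (phat ω) ω‖ ^ 2
            + LassoSelection.lam ε (phat ω)
              * LassoSelection.l1Norm φ (phat ω) (fhat (phat ω) ω)
            + LassoSelection.pen ε (phat ω)) ∂P
          ≤ C * ((⨅ p : LassoSelection.dyadic,
                ((⨅ h : LassoSelection.spanTrunc φ p,
                    (‖f - (h : H)‖ ^ 2
                      + LassoSelection.lam ε p * LassoSelection.l1Norm φ p h))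
                  + LassoSelection.pen ε p))
              + ε ^ 2) := by
  -- `576 = 24 * 24`, from `loss_le_of_noise_le` and the bound `24` of the mean of `D²`.
  refine ⟨576, by norm_num, ?_⟩
  intro Ω _ P _ H _ _ _ _ W φ f ε fhat phat hW hL hφ hε hfm hpm hlasso hsel
  open LassoSelection in
  let loss : Ω → ℝ := fun ω =>
    ‖f - fhat (phat ω) ω‖ ^ 2 + lam ε (phat ω) * l1Norm φ (phat ω) (fhat (phat ω) ω)
      + pen ε (phat ω)
  have hlasso' : ∀ᵐ ω ∂P, ∀ p, p ∈ dyadic → IsLasso φ ε (fun h => obs f ε W h ω) p (fhat p ω) := by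
    refine ae_all_iff.2 fun p => ?_
    by_cases hp : p ∈ dyadic
    · filter_upwards [hlasso p hp] with ω hω _ using hω
    · exact Filter.Eventually.of_forall fun ω h => absurd h hp
  have hloss0 : ∀ ω, 0 ≤ loss ω := fun ω => by
    have h1 := mul_nonneg (lam_nonneg hε (phat ω)) (l1Norm_nonneg φ (phat ω) (fhat (phat ω) ω))
    have h2 := pen_nonneg ε (phat ω)
    positivity
  have hlossm : AEStronglyMeasurable loss P := by
    refine aestronglyMeasurable_comp_countable (S := dyadic)
      (F := fun p ω => ‖f - fhat p ω‖ ^ 2 + lam ε p * l1Norm φ p (fhat p ω) + pen ε p)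
      hpm (hsel.mono fun ω hω => hω.1) fun p hp => ?_
    obtain ⟨F, hF, hFe⟩ := exists_continuous_eq_l1Norm φ p
    have hl1 : AEStronglyMeasurable (fun ω => l1Norm φ p (fhat p ω)) P := by
      refine (hF.comp_aestronglyMeasurable (hfm p hp)).congr ?_
      filter_upwards [hlasso p hp] with ω hω using hFe _ hω.1
    exact ((((aestronglyMeasurable_const).sub (hfm p hp)).norm.pow 2).add
      (hl1.const_mul _)).add aestronglyMeasurable_const
  -- The oracle inequality for one competitor `h` of level `p`.
  have key : ∀ p ∈ dyadic, ∀ h ∈ spanTrunc φ p,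
      Integrable loss P ∧ ∫ ω, loss ω ∂P
        ≤ 20 * (‖f - h‖ ^ 2 + lam ε p * l1Norm φ p h + pen ε p) + 576 * ε ^ 2 := by
    intro p hp h hh
    have hb : 0 ≤ lam ε p * l1Norm φ p h := mul_nonneg (lam_nonneg hε p) (l1Norm_nonneg φ p h)
    have hc := pen_nonneg ε p
    set A := ‖f - h‖ ^ 2 + lam ε p * l1Norm φ p h + pen ε p with hA
    have hA0 : 0 ≤ A := by positivity
    refine integrable_and_integral_le_of_lintegral (by positivity) hlossm
      (Filter.Eventually.of_forall hloss0) ?_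
    refine lintegral_le_of_forall_nat hpm fun N => ?_
    obtain ⟨D, hD, hnoise⟩ :=
      exists_noise_bound hW hL hφ hε (spanTrunc_le_spanDict φ p hh) N
    refine ⟨fun ω => ENNReal.ofReal (20 * A)
      + ENNReal.ofReal (24 * ε ^ 2) * ENNReal.ofReal (D ω ^ 2), ?_, ?_⟩
    · filter_upwards [hnoise, hlasso', hsel] with ω h1 h2 h3 hN
      rw [← ENNReal.ofReal_mul (by positivity),
        ← ENNReal.ofReal_add (by positivity) (by positivity)]
      refine ENNReal.ofReal_le_ofReal ?_
      have hg := (h2 _ h3.1).1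
      have h4 := h1 _ hN _ hg
      have h5 := h3.2 p hp
      have h6 := (h2 p hp).2 h hh
      have h7 : 4 * ε * ‖h‖ ≤ lam ε p * l1Norm φ p h := by
        have : 4 * ε ≤ lam ε p := by
          unfold lam
          nlinarith [Real.sqrt_nonneg (Real.log p)]
        exact mul_le_mul this (norm_le_l1Norm hφ hh) (norm_nonneg _) (lam_nonneg hε p)
      refine loss_le_of_noise_le (w := W (fhat (phat ω) ω) ω) (v := W h ω) hc (pen_nonneg ε _) hε.le
        ?_ ?_
      · simp only [gam, obs] at h5 h6
        linarith
      · linarith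
    · rw [lintegral_add_left measurable_const, lintegral_const_mul' _ _ ENNReal.ofReal_ne_top,
        lintegral_const, measure_univ, mul_one]
      calc ENNReal.ofReal (20 * A)
            + ENNReal.ofReal (24 * ε ^ 2) * ∫⁻ ω, ENNReal.ofReal (D ω ^ 2) ∂P
          ≤ ENNReal.ofReal (20 * A) + ENNReal.ofReal (24 * ε ^ 2) * ENNReal.ofReal 24 := by
            gcongr
            simpa using hD
        _ = ENNReal.ofReal (20 * A + 576 * ε ^ 2) := by
            rw [← ENNReal.ofReal_mul (by positivity),
              ← ENNReal.ofReal_add (by positivity) (by positivity)]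
            congr 1
            ring
  have h1 : (1 : ℕ) ∈ dyadic := ⟨0, rfl⟩
  have : Nonempty dyadic := ⟨⟨1, h1⟩⟩
  refine ⟨(key 1 h1 0 (zero_mem _)).1, ?_⟩
  have hinf : (∫ ω, loss ω ∂P) / 576 - ε ^ 2 ≤ ⨅ p : dyadic,
      ((⨅ h : spanTrunc φ p, (‖f - (h : H)‖ ^ 2 + lam ε p * l1Norm φ p h)) + pen ε p) := by
    refine le_ciInf fun p => ?_
    rw [← sub_le_iff_le_add]
    refine le_ciInf fun h => ?_
    have hk := (key p p.2 h h.2).2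
    have hb := mul_nonneg (lam_nonneg hε p) (l1Norm_nonneg φ p (h : H))
    have hc := pen_nonneg ε p
    have ha : 0 ≤ ‖f - (h : H)‖ ^ 2 := by positivity
    linarith
  change ∫ ω, loss ω ∂P ≤ _
  linarith
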